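/- Let $C$ be a field of characteristic zero, $\mathbb F=C(x)$, and let $\sigma_y,\sigma_z$ be the $\mathbb F$-automorphisms of $\mathbb F(y,z)$ given by $\sigma_y f(y,z)=f(y+1,z)$ and $\sigma_z f(y,z)=f(y,z+1)$. A rational function $f\in\mathbb F(y,z)$ is called $(\sigma_y,\sigma_z)$-summable if $f=\sigma_y(g)-g+\sigma_z(h)-h$ for some $g,h\in\mathbb F(y,z)$. Polynomials $p,q\in\mathbb F[y,z]$ are $(y,z)$-shift equivalent, $p\sim_{y,z}q$, if $p=\sigma_y^m\sigma_z^n(q)$ for some $m,n\in\mathbb Z$. A polynomial is monic if the coefficient of its highest term with respect to the pure lexicographic order $y\prec z$ is one. An irreducible polynomial $d\in\mathbb F[y,z]$ is $(y,z)$-integer linear of $(\alpha,\beta)$-type if $d=p(\alpha y+\beta z)$ for some univariate $p$ over $\mathbb F$ and coprime integers $\alpha,\beta$ with $\beta\ge 0$. The degree of the zero polynomial is $-\infty$. A fraction $a/(b\,d^j)$ with $a,d\in\mathbb F[y,z]$, $b\in\mathbb F[y]\setminus\{0\}$ and $j\ge 1$ is called a remainder fraction if $\deg_z a<\deg_z d$;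 $d$ is monic, irreducible and of positive degree in $z$; and, in case $d$ is $(y,z)$-integer linear of $(\alpha,\beta)$-type, (i) $a=\sum_{i=0}^{\deg_z a}\hat a_i\,(\alpha y+\beta z)^i$ for some $\hat a_i\in\mathbb F[y]$ with $\deg_y\hat a_i<\deg_y b$, and (ii) $b$ is $\sigma_y^\beta$-free, i.e. $\gcd(b,\sigma_y^{\beta\ell}(b))=1$ for all nonzero $\ell\in\mathbb Z$. Let $f\in\mathbb F(y,z)$. A rational function $r\in\mathbb F(y,z)$ is a $(\sigma_y,\sigma_z)$-remainder of $f$ if $f-r$ is $(\sigma_y,\sigma_z)$-summable and $r$ can be written in a remainder form $$r=\sum_{i=1}^m\sum_{j=1}^{n_i}\frac{a_{ij}}{b_{ij}d_i^j},\qquad m,n_i\in\mathbb N,$$ where every $a_{ij}/(b_{ij}d_i^j)$ is a remainder fraction, every $d_i$ is a factor of the denominator of $r$, and $d_i\not\sim_{y,z}d_{i'}$ whenever $i\ne i'$. Proposition. Let $r$ be a nonzero $(\sigma_y,\sigma_z)$-remainder of some $f\in\mathbb F(y,z)$. Then, for every remainder form of $r$ as above, each nonzero fraction $a_{ij}/(b_{ij}d_i^j)$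 with $1\le i\le m$ and $1\le j\le n_i$ is not $(\sigma_y,\sigma_z)$-summable. Moreover, $r$ itself is not $(\sigma_y,\sigma_z)$-summable. -/

import Mathlib

open Polynomial

noncomputable section

namespace BivSum

/-- The polynomial ring `F[y, z]`, realised as `F[y][z]`: the inner variable is `y`, the outer
variable is `z`. In particular `degree` is the degree in `z`, and `Polynomial.C` is the inclusion
of `F[y]` into `F[y, z]`. -/
abbrev Poly (F : Type*) [Field F] : Type _ := Polynomial (Polynomial F)

/-- The field `F(y, z)` of rational functions. -/
abbrev RatFun (F : Type*) [Field F] : Type _ := FractionRing (Poly F)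

variable {F : Type*} [Field F]

/-- The inclusion of `F[y, z]` into `F(y, z)`. -/
abbrev toRat (p : Poly F) : RatFun F := algebraMap (Poly F) (RatFun F) p

/-- The shift `p(y, z) ↦ p(y + 1, z)` on `F[y, z]`. -/
def shiftY : RingAut (Poly F) := Polynomial.mapEquiv (algEquivAevalXAddC (1 : F)).toRingEquiv

/-- The shift `p(y, z) ↦ p(y, z + 1)` on `F[y, z]`. -/
def shiftZ : RingAut (Poly F) := (algEquivAevalXAddC (1 : Polynomial F)).toRingEquiv

/-- The extension of an automorphism of `F[y, z]` to `F(y, z)`. -/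
def extend (τ : RingAut (Poly F)) : RingAut (RatFun F) := IsFractionRing.ringEquivOfRingEquiv τ

/-- The shift operator `σ_y` of `F(y, z)`. -/
def sigmaY : RingAut (RatFun F) := extend shiftY

/-- The shift operator `σ_z` of `F(y, z)`. -/
def sigmaZ : RingAut (RatFun F) := extend shiftZ

/-- `f` is `(σ_y, σ_z)`-summable: `f = σ_y(g) - g + σ_z(h) - h` for some `g, h ∈ F(y, z)`. -/
def IsSummable (f : RatFun F) : Prop :=
  ∃ g h : RatFun F, f = (sigmaY g - g) + (sigmaZ h - h)

/-- `p` is `τ`-free: `gcd(p, τ^ℓ(p)) = 1` for all nonzero integers `ℓ`. -/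
def IsFree (τ : RingAut (Poly F)) (p : Poly F) : Prop :=
  ∀ l : ℤ, l ≠ 0 → IsRelPrime p ((τ ^ l) p)

/-- `p` and `q` are `(y, z)`-shift equivalent: `p = σ_y^m σ_z^n (q)` for some integers `m, n`. -/
def ShiftEquiv (p q : Poly F) : Prop :=
  ∃ m n : ℤ, p = (shiftY ^ m * shiftZ ^ n : RingAut (Poly F)) q

/-- The linear form `α y + β z`. -/
def linForm (α β : ℤ) : Poly F := (α : Poly F) * C X + (β : Poly F) * X

/-- `d` is `(y, z)`-integer linear of `(α, β)`-type: `d = p(α y + β z)` with `p` univariate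
over `F`, where `α, β` are coprime integers and `β ≥ 0`. -/
def IsIntegerLinearOfType (d : Poly F) (α β : ℤ) : Prop :=
  IsCoprime α β ∧ 0 ≤ β ∧ ∃ p : Polynomial F, d = aeval (linForm α β) p

/-- `d` is monic with respect to the pure lexicographic order with `y ≺ z`: the coefficient of
its highest term is one. -/
def IsLexMonic (d : Poly F) : Prop := d.leadingCoeff.leadingCoeff = 1

/-- The rational function `a / (b d^j)` with `a, d ∈ F[y, z]` and `b ∈ F[y]`. -/
def frac (a : Poly F) (b : Polynomial F) (d : Poly F) (j : ℕ) : RatFun F :=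
  toRat a / (toRat (C b) * toRat d ^ j)

/-- `a / (b d^j)`, with `a, d ∈ F[y, z]`, `b ∈ F[y]` and `j ≥ 1`, is a remainder fraction. -/
structure IsRemainderFraction (a : Poly F) (b : Polynomial F) (d : Poly F) (j : ℕ) : Prop where
  pos : 0 < j
  denom_ne_zero : b ≠ 0
  degree_lt : a.degree < d.degree
  monic : IsLexMonic d
  irreducible : Irreducible d
  degree_pos : 0 < d.degree
  /-- If `d` is integer linear of `(α, β)`-type, then `a = ∑ i, a_i (α y + β z)^i`,
  where `a_i ∈ F[y]` and `deg_y a_i < deg_y b`. -/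
  numer_of_integerLinear : ∀ α β : ℤ, IsIntegerLinearOfType d α β →
    ∃ c : ℕ → Polynomial F, (∀ i ≤ a.natDegree, (c i).degree < b.degree) ∧
      a = ∑ i ∈ Finset.range (a.natDegree + 1), C (c i) * linForm α β ^ i
  /-- If `d` is integer linear of `(α, β)`-type, then `b` is `σ_y^β`-free. -/
  denom_of_integerLinear : ∀ α β : ℤ, IsIntegerLinearOfType d α β →
    IsFree (shiftY ^ β) (C b)

/-- The data `m, n_i, a_ij, b_ij, d_i` are a remainder form of `r`. The indices run from `0`,
so the fraction with index `j : Fin (n i)` has exponent `j + 1`. -/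
structure IsRemainderForm (r : RatFun F) (m : ℕ) (n : Fin m → ℕ)
    (a : (i : Fin m) → Fin (n i) → Poly F) (b : (i : Fin m) → Fin (n i) → Polynomial F)
    (d : Fin m → Poly F) : Prop where
  eq_sum : r = ∑ i, ∑ j : Fin (n i), frac (a i j) (b i j) (d i) (j + 1)
  remainderFraction : ∀ i (j : Fin (n i)), IsRemainderFraction (a i j) (b i j) (d i) (j + 1)
  dvd_denom : ∀ i, d i ∣ (IsFractionRing.den (Poly F) r : Poly F)
  not_shiftEquiv : ∀ i i', i ≠ i' → ¬ ShiftEquiv (d i) (d i')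

/-- `r` is a `(σ_y, σ_z)`-remainder of `f`. -/
def IsRemainder (f r : RatFun F) : Prop :=
  IsSummable (f - r) ∧ ∃ m n a b d, IsRemainderForm r m n a b d

end BivSum

end

/-! View `F(y, z)` as rational functions in `z` over `F(y)`. Partial fractions split it into a
polynomial part and one summand for each pair of a lexicographically monic irreducible `d` and an
order `j` (`isInternal_part`). The group of shifts `σ_y^m σ_z^n` permutes these summands, and
summable functions die in the coinvariants. Modulo this action an orbit of summands collapses to one
of them, taken modulo the stabilizer of its index (`DirectSum.IsInternal.exists_invariant_hom`). In
a remainder form distinct fractions lie in distinct orbits, so both claims reduce to one: a nonzero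
remainder fraction survives in the coinvariants of the stabilizer of its pole.

If `d` is not integer linear, the stabilizer is trivial (`exists_isIntegerLinearOfType`). Otherwise
it is generated by `τ = σ_y^β σ_z^(-α)` (`eq_zpow_of_isIntegerLinearOfType`). In the coordinates
`y`, `w = α y + β z`, `τ` only moves `y` to `y + β`, so comparing powers of `w` leaves equations `c
/ b = u(y + β) - u(y)` over `F` with `c / b` proper and `b` free. Looking at the extreme poles of
`u` gives `c = 0` (`Polynomial.eq_zero_of_mul_comp_eq`). -/

/-! ### Division and Bézout relations up to constants -/

/-- Pseudo-division of polynomials over a domain. -/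
theorem Polynomial.exists_C_mul_eq_mul_add {R : Type*} [CommRing R] [IsDomain R] {d : R[X]}
    (hd : d ≠ 0) (a : R[X]) :
    ∃ b : R, b ≠ 0 ∧ ∃ q r : R[X], C b * a = q * d + r ∧ r.degree < d.degree := by
  induction h : a.degree using WellFoundedLT.induction generalizing a with
  | ind n ih =>
    subst h
    by_cases hlt : a.degree < d.degree
    · exact ⟨1, one_ne_zero, 0, a, by simp, hlt⟩
    · have hle : d.degree ≤ a.degree := not_lt.mp hlt
      have ha : a ≠ 0 := by
        rintro rfl
        exact hd (by simpa using hle)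
      have hlcd : d.leadingCoeff ≠ 0 := leadingCoeff_ne_zero.2 hd
      have hlca : a.leadingCoeff ≠ 0 := leadingCoeff_ne_zero.2 ha
      set t : R[X] := C a.leadingCoeff * X ^ (a.natDegree - d.natDegree)
      have hdeg : (C d.leadingCoeff * a - t * d).degree < a.degree := by
        have h1 : (C d.leadingCoeff * a).degree = a.degree := by
          rw [degree_mul, degree_C hlcd, zero_add]
        have h2 : (t * d).degree = a.degree := by
          rw [degree_mul, degree_C_mul_X_pow _ hlca, degree_eq_natDegree hd,
            degree_eq_natDegree ha, ← Nat.cast_add,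
            Nat.sub_add_cancel (natDegree_le_natDegree hle)]
        rw [← h1]
        refine degree_sub_lt_left (h1.trans h2.symm) (mul_ne_zero (C_ne_zero.2 hlcd) ha) ?_
        rw [leadingCoeff_mul, leadingCoeff_mul, leadingCoeff_C, leadingCoeff_C_mul_X_pow, mul_comm]
      obtain ⟨b, hb, q, r, heq, hr⟩ := ih _ hdeg _ rfl
      refine ⟨b * d.leadingCoeff, mul_ne_zero hb hlcd, q + C b * t, r, ?_, hr⟩
      rw [C_mul]
      linear_combination heq

/-- Two relatively prime polynomials over a unique factorization domain combine to a nonzero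
constant. -/
theorem Polynomial.exists_mul_add_mul_eq_C {R : Type*} [CommRing R] [IsDomain R]
    [UniqueFactorizationMonoid R] {p q : R[X]} (hpq : IsRelPrime p q) :
    ∃ b : R, b ≠ 0 ∧ ∃ u v : R[X], u * p + v * q = C b := by
  let : NormalizedGCDMonoid R := Nonempty.some inferInstance
  have hne : ∃ g ∈ Ideal.span {p, q}, g ≠ 0 := by
    by_contra! h
    have hp : p = 0 := h p (Ideal.subset_span (by simp))
    have hq : q = 0 := h q (Ideal.subset_span (by simp))
    subst hp hq
    exact not_isUnit_zero (hpq dvd_rfl dvd_rfl)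
  -- By pseudo-division and Gauss's lemma, the primitive part of an element of least degree divides
  -- `p` and `q`. It is therefore a unit, and `g` is a constant.
  obtain ⟨g, ⟨hgI, hg0⟩, hmin⟩ := exists_minimalFor_of_wellFoundedLT
    (fun g : R[X] => g ∈ Ideal.span {p, q} ∧ g ≠ 0) degree hne
  have hdvd : ∀ a ∈ Ideal.span {p, q}, g.primPart ∣ a := by
    intro a ha
    obtain ⟨b, hb, s, r, heq, hr⟩ := exists_C_mul_eq_mul_add hg0 a
    have hrI : r ∈ Ideal.span {p, q} := by
      have : r = C b * a - s * g := by rw [heq]; ring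
      rw [this]
      exact sub_mem (Ideal.mul_mem_left _ _ ha) (Ideal.mul_mem_left _ _ hgI)
    have hr0 : r = 0 := by
      by_contra hr0
      exact absurd hr (not_lt.2 (hmin ⟨hrI, hr0⟩ hr.le))
    refine g.isPrimitive_primPart.dvd_of_fraction_map_dvd_fraction_map
      (K := FractionRing R) ?_
    have h1 : g.primPart ∣ C b * a := by
      rw [heq, hr0, add_zero]
      exact (g.primPart_dvd).mul_left s
    have h2 := Polynomial.map_dvd (algebraMap R (FractionRing R)) h1
    rw [Polynomial.map_mul, map_C] at h2
    refine (IsUnit.dvd_mul_left ?_).1 h2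
    exact isUnit_C.2 (isUnit_iff_ne_zero.2 (by simpa using hb))
  obtain ⟨c, hc, hcu⟩ := isUnit_iff.1
    (hpq (hdvd p (Ideal.subset_span (by simp))) (hdvd q (Ideal.subset_span (by simp))))
  obtain ⟨u, v, huv⟩ := Ideal.mem_span_pair.1 hgI
  refine ⟨g.content * c, mul_ne_zero (by simpa [content_eq_zero_iff] using hg0) hc.ne_zero,
    u, v, ?_⟩
  rw [huv, C_mul, hcu]
  exact g.eq_C_content_mul_primPart

/-! ### Coinvariants of a permuted direct sum -/

/-- A grading indexed by a set on which a group acts compatibly: for each index there is an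
invariant homomorphism which, modulo the elements `g • v - v` with `g` in the stabilizer, is the
identity on the summand of that index and vanishes on the summands outside the orbit. -/
theorem DirectSum.IsInternal.exists_invariant_hom {G I A : Type*} [Group G] [DecidableEq I]
    [AddCommGroup A] [MulAction G I] [DistribMulAction G A] {V : I → AddSubgroup A}
    (hV : DirectSum.IsInternal V) (hsmul : ∀ (g : G) (i : I), ∀ v ∈ V i, g • v ∈ V (g • i))
    (i₀ : I) (N : AddSubgroup A)
    (hN : ∀ g : G, g • i₀ = i₀ → ∀ v ∈ V i₀, g • v - v ∈ N) :
    ∃ φ : A →+ A ⧸ N, (∀ (g : G) (x : A), φ (g • x) = φ x) ∧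
      (∀ v ∈ V i₀, φ v = QuotientAddGroup.mk' N v) ∧
      ∀ i ∉ MulAction.orbit G i₀, ∀ v ∈ V i, φ v = 0 := by
  classical
  -- `rep i` carries `i₀` to `i`, and `φ` brings `V i` back by its inverse. Two choices differ by a
  -- stabilizer element, which is invisible modulo `N`.
  have hrep : ∀ i, ∃ g : G, i ∈ MulAction.orbit G i₀ → g • i₀ = i := by
    intro i
    by_cases h : i ∈ MulAction.orbit G i₀
    · obtain ⟨g, hg⟩ := h
      exact ⟨g, fun _ => hg⟩
    · exact ⟨1, fun h' => absurd h' h⟩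
  choose rep hrep using hrep
  let ψ : ∀ i, V i →+ A ⧸ N := fun i =>
    if i ∈ MulAction.orbit G i₀ then
      (QuotientAddGroup.mk' N).comp ((DistribSMul.toAddMonoidHom A (rep i)⁻¹).comp (V i).subtype)
    else 0
  let e := AddEquiv.ofBijective _ hV
  let φ : A →+ A ⧸ N := (DirectSum.toAddMonoid ψ).comp e.symm.toAddMonoidHom
  have hφ : ∀ i (v : A) (hv : v ∈ V i), φ v = ψ i ⟨v, hv⟩ := by
    intro i v hv
    have : e.symm v = DirectSum.of (fun i => V i) i ⟨v, hv⟩ := by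
      rw [AddEquiv.symm_apply_eq]
      exact (DirectSum.coeAddMonoidHom_of V i ⟨v, hv⟩).symm
    simp [φ, this]
  have hin : ∀ i ∈ MulAction.orbit G i₀, ∀ v ∈ V i,
      φ v = QuotientAddGroup.mk' N ((rep i)⁻¹ • v) := by
    intro i hi v hv
    rw [hφ i v hv]
    simp [ψ, hi]
  have hstab : ∀ g : G, g • i₀ = i₀ → ∀ v ∈ V i₀,
      QuotientAddGroup.mk' N (g • v) = QuotientAddGroup.mk' N v := by
    intro g hg v hv
    rw [← sub_eq_zero, ← map_sub]
    exact (QuotientAddGroup.eq_zero_iff _).2 (hN g hg v hv)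
  have hout : ∀ i ∉ MulAction.orbit G i₀, ∀ v ∈ V i, φ v = 0 := by
    intro i hi v hv
    rw [hφ i v hv]
    simp [ψ, hi]
  refine ⟨φ, fun g x => ?_, fun v hv => ?_, hout⟩
  · obtain ⟨y, rfl⟩ := hV.2 x
    induction y using DirectSum.induction_on with
    | zero => simp
    | add y z hy hz => simp only [map_add, smul_add, hy, hz]
    | of i v =>
      rw [DirectSum.coeAddMonoidHom_of]
      by_cases hi : i ∈ MulAction.orbit G i₀
      · have hgi : g • i ∈ MulAction.orbit G i₀ := MulAction.mem_orbit_of_mem_orbit g hi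
        rw [hin _ hgi _ (hsmul g i v v.2), hin i hi v v.2]
        have h1 : (rep i)⁻¹ • (v : A) ∈ V i₀ := by
          have := hsmul (rep i)⁻¹ i v v.2
          rwa [inv_smul_eq_iff.2 (hrep i hi).symm] at this
        have h2 := hstab ((rep (g • i))⁻¹ * g * rep i)
          (by rw [mul_smul, mul_smul, hrep i hi, inv_smul_eq_iff, hrep _ hgi]) _ h1
        rwa [mul_smul, mul_smul, smul_inv_smul] at h2
      · have hgi : g • i ∉ MulAction.orbit G i₀ := fun h => hi <| by
          simpa using MulAction.mem_orbit_of_mem_orbit g⁻¹ h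
        rw [hout _ hgi _ (hsmul g i v v.2), hout i hi v v.2]
  -- `rep i₀` need not be `1`, but it fixes `i₀`.
  · have hi₀ : i₀ ∈ MulAction.orbit G i₀ := MulAction.mem_orbit_self i₀
    rw [hin i₀ hi₀ v hv]
    exact hstab _ (inv_smul_eq_iff.2 (hrep i₀ hi₀).symm) v hv

/-! ### Univariate difference equations -/

/-- A nonzero polynomial whose roots contain `x` has, along any arithmetic progression through
`x`, a last root. -/
theorem Polynomial.exists_isRoot_add_nsmul_not_isRoot {L : Type*} [Field L] [CharZero L]
    {p : L[X]} (hp : p ≠ 0) {s : L} (hs : s ≠ 0) {x : L} (hx : p.IsRoot x) :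
    ∃ k : ℕ, p.IsRoot (x + k * s) ∧ ¬ p.IsRoot (x + k * s + s) := by
  by_contra! h
  have hall : ∀ k : ℕ, p.IsRoot (x + k * s) := by
    intro k
    induction k with
    | zero => simpa using hx
    | succ k ih =>
      have := h k ih
      push_cast
      convert this using 1
      ring
  refine hp (eq_zero_of_infinite_isRoot p (Set.infinite_of_injective_forall_mem
    (f := fun k : ℕ => x + k * s) ?_ hall))
  intro k l hkl
  simpa [hs] using hkl

/-- In characteristic zero, only constant polynomials are periodic. -/
theorem Polynomial.natDegree_eq_zero_of_comp_X_add_C_eq {L : Type*} [Field L] [CharZero L]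
    {p : L[X]} {s : L} (hs : s ≠ 0) (h : p.comp (X + C s) = p) : p.natDegree = 0 := by
  -- By periodicity, the root `0` of this difference would propagate forever along the multiples of
  -- `s`.
  suffices hp : p - C (p.eval 0) = 0 by
    rw [sub_eq_zero.1 hp, natDegree_C]
  by_contra hp
  obtain ⟨k, hk, hk'⟩ := exists_isRoot_add_nsmul_not_isRoot hp hs (x := 0) (by simp)
  apply hk'
  have := congrArg (eval (0 + k * s)) h
  simp only [eval_comp, eval_add, eval_X, eval_C] at this
  simp only [IsRoot.def, eval_sub, eval_C] at hk ⊢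
  rwa [this]

/-- A proper fraction `c / b` with `b` coprime to all its nontrivial translates by multiples of `s`
is not a difference `u(y + s) - u(y)`, unless it is zero. -/
theorem Polynomial.eq_zero_of_mul_comp_eq {L : Type*} [Field L] [CharZero L]
    {b c b' c' : L[X]} {s : L} (hs : s ≠ 0)
    (hb : ∀ k : ℕ, k ≠ 0 → IsRelPrime b (b.comp (X + C (k * s))))
    (hb' : b' ≠ 0) (hdeg : c.degree < b.degree)
    (h : c * (b' * b'.comp (X + C s)) =
      b * (c'.comp (X + C s) * b' - c' * b'.comp (X + C s))) : c = 0 := by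
  -- reduce to the case of coprime `b'` and `c'`
  wlog hcop : IsCoprime b' c' generalizing b' c'
  · obtain ⟨g, b₁, c₁, hcop', hg⟩ : ∃ g b₁ c₁, IsCoprime b₁ c₁ ∧ b' = g * b₁ ∧ c' = g * c₁ := by
      classical
      have hg0 : EuclideanDomain.gcd b' c' ≠ 0 := fun h0 =>
        hb' (EuclideanDomain.gcd_eq_zero_iff.1 h0).1
      obtain ⟨b₁, hb₁⟩ := EuclideanDomain.gcd_dvd_left b' c'
      obtain ⟨c₁, hc₁⟩ := EuclideanDomain.gcd_dvd_right b' c'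
      refine ⟨EuclideanDomain.gcd b' c', b₁, c₁, ?_, hb₁, hc₁⟩
      refine ⟨EuclideanDomain.gcdA b' c', EuclideanDomain.gcdB b' c', mul_left_cancel₀ hg0 ?_⟩
      have := EuclideanDomain.gcd_eq_gcd_ab b' c'
      linear_combination -EuclideanDomain.gcdA b' c' * hb₁ -
        EuclideanDomain.gcdB b' c' * hc₁ - this
    obtain ⟨rfl, rfl⟩ := hg
    have hg0 : g ≠ 0 := left_ne_zero_of_mul hb'
    have hg1 : g.comp (X + C s) ≠ 0 := by
      rw [← taylor_apply]
      simpa using hg0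
    refine this (right_ne_zero_of_mul hb') (mul_left_cancel₀ (mul_ne_zero hg0 hg1) ?_) hcop'
    simp only [mul_comp] at h
    linear_combination h
  -- pass to an algebraic closure
  let i := algebraMap L (AlgebraicClosure L)
  have hcommon : ∀ (k : ℕ) (x : AlgebraicClosure L), k ≠ 0 → (b.map i).IsRoot x →
      (b.map i).IsRoot (x + k * i s) → False := by
    intro k x hk h1 h2
    obtain ⟨u, v, huv⟩ := (hb k hk).isCoprime
    have := congrArg (fun p => (p.map i).eval x) huv
    simp only [Polynomial.map_add, Polynomial.map_mul, Polynomial.map_comp, map_X, map_C, eval_add,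
      eval_mul, eval_comp, eval_X, eval_C, map_mul, map_natCast, h1.eq_zero] at this
    simp [h2.eq_zero] at this
  have hev : ∀ x : AlgebraicClosure L,
      (c.map i).eval x * ((b'.map i).eval x * (b'.map i).eval (x + i s)) =
      (b.map i).eval x * ((c'.map i).eval (x + i s) * (b'.map i).eval x -
        (c'.map i).eval x * (b'.map i).eval (x + i s)) := by
    intro x
    have := congrArg (fun p => (p.map i).eval x) h
    simpa only [Polynomial.map_sub, Polynomial.map_add, Polynomial.map_mul, Polynomial.map_comp,
      map_X, map_C, eval_add, eval_sub, eval_mul, eval_comp, eval_X, eval_C] using this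
  have hne : ∀ x, (b'.map i).eval x = 0 → (c'.map i).eval x ≠ 0 := by
    intro x h1 h2
    obtain ⟨u, v, huv⟩ := hcop
    have := congrArg (fun p => (p.map i).eval x) huv
    simp [h1, h2] at this
  -- If `c' / b'` is a polynomial, then `b ∣ c`, and properness forces `c = 0`.
  by_cases hunit : b'.degree = 0
  · by_contra hc
    rw [eq_C_of_degree_eq_zero hunit] at h
    have hb0 : b'.coeff 0 ≠ 0 := coeff_ne_zero_of_eq_degree hunit
    have hd : b ∣ c * (C (b'.coeff 0) * C (b'.coeff 0)) :=
      ⟨_, by simpa only [C_comp] using h⟩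
    rw [← C_mul] at hd
    have hu : IsUnit (C (b'.coeff 0 * b'.coeff 0)) :=
      isUnit_C.2 (isUnit_iff_ne_zero.2 (mul_ne_zero hb0 hb0))
    exact absurd (degree_le_of_dvd (hu.dvd_mul_right.1 hd) hc) (not_le.2 hdeg)
  · exfalso
    have hi : Function.Injective i := i.injective
    have his : i s ≠ 0 := by simpa using hs
    -- Follow the roots of `b'` from `θ` until they stop, at `θ + k s` forwards and at `θ - l s`
    -- backwards. At `θ + k s` and `θ - (l + 1) s` only one of `c' / b'` and its shift has a pole,
    -- so nothing cancels and `b` vanishes at both. These points are `k + l + 1` steps apart,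
    -- against freeness.
    obtain ⟨θ, hθ⟩ := IsAlgClosed.exists_root (b'.map i) (by rwa [degree_map])
    have hb0 : b'.map i ≠ 0 := (Polynomial.map_ne_zero_iff hi).2 hb'
    obtain ⟨k, hk, hk'⟩ := exists_isRoot_add_nsmul_not_isRoot hb0 his hθ
    obtain ⟨l, hl, hl'⟩ := exists_isRoot_add_nsmul_not_isRoot hb0 (neg_ne_zero.2 his) hθ
    simp only [IsRoot.def] at hk hk' hl hl'
    have h1 : (b.map i).IsRoot (θ + k * i s) := by
      have h := hev (θ + k * i s)
      rw [hk] at h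
      have := hne _ hk
      simp only [zero_mul, mul_zero, zero_sub] at h
      simpa [this, hk'] using h.symm
    have h2 : (b.map i).IsRoot (θ + l * (- i s) + - i s) := by
      have h := hev (θ + l * (- i s) + - i s)
      rw [neg_add_cancel_right, hl] at h
      simp only [mul_zero, sub_zero] at h
      exact (mul_eq_zero.1 h.symm).resolve_right (mul_ne_zero (hne _ hl) hl')
    refine hcommon (k + l + 1) _ (by omega) h2 ?_
    convert h1 using 1
    push_cast
    ring

noncomputable section

namespace BivSum

variable {F : Type*} [Field F]

/-! ### Partial fractions with respect to `z` -/

theorem toRat_injective : Function.Injective (toRat : Poly F → RatFun F) :=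
  IsFractionRing.injective _ _

@[simp] theorem toRat_eq_zero {p : Poly F} : toRat p = 0 ↔ p = 0 :=
  IsFractionRing.to_map_eq_zero_iff

variable (F) in
/-- A lexicographically monic irreducible polynomial of positive degree in `z`, together with a
positive multiplicity: an index of the partial fraction decomposition with respect to `z`. -/
@[ext] structure Pole where
  poly : Poly F
  order : ℕ
  lexMonic : IsLexMonic poly
  irreducible : Irreducible poly
  degree_pos : 0 < poly.degree
  order_pos : 0 < order

theorem frac_add_frac {a a' : Poly F} {b b' : F[X]} {d : Poly F} {j : ℕ} (hb : b ≠ 0)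
    (hb' : b' ≠ 0) (hd : d ≠ 0) :
    frac a b d j + frac a' b' d j = frac (C b' * a + C b * a') (b * b') d j := by
  have h1 : toRat (C b) ≠ 0 := by simpa using hb
  have h2 : toRat (C b') ≠ 0 := by simpa using hb'
  have h3 : toRat d ≠ 0 := by simpa using hd
  simp only [frac, toRat, map_add, map_mul] at *
  field_simp

theorem neg_frac (a : Poly F) (b : F[X]) (d : Poly F) (j : ℕ) :
    - frac a b d j = frac (-a) b d j := by
  simp [frac, neg_div]

/-- The fractions `a / (b d^j)` with `b ∈ F[y]` and `deg_z a < deg_z d`. -/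
def Pole.part (i : Pole F) : AddSubgroup (RatFun F) where
  carrier := {x | ∃ a b, b ≠ 0 ∧ a.degree < i.poly.degree ∧ x = frac a b i.poly i.order}
  zero_mem' := ⟨0, 1, one_ne_zero, by
    simpa using bot_lt_iff_ne_bot.2 i.degree_pos.ne_bot, by simp [frac]⟩
  add_mem' := by
    rintro _ _ ⟨a, b, hb, ha, rfl⟩ ⟨a', b', hb', ha', rfl⟩
    refine ⟨_, _, mul_ne_zero hb hb', ?_, frac_add_frac hb hb' i.irreducible.ne_zero⟩
    refine (degree_add_le _ _).trans_lt (max_lt ?_ ?_)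
    · rwa [degree_C_mul hb']
    · rwa [degree_C_mul hb]
  neg_mem' := by
    rintro _ ⟨a, b, hb, ha, rfl⟩
    exact ⟨-a, b, hb, by rwa [degree_neg], neg_frac a b _ _⟩

variable (F) in
/-- The fractions `a / b` with `b ∈ F[y]`. -/
def polynomialPart : AddSubgroup (RatFun F) where
  carrier := {x | ∃ a b, b ≠ 0 ∧ x = frac a b 1 0}
  zero_mem' := ⟨0, 1, one_ne_zero, by simp [frac]⟩
  add_mem' := by
    rintro _ _ ⟨a, b, hb, rfl⟩ ⟨a', b', hb', rfl⟩
    exact ⟨_, _, mul_ne_zero hb hb', frac_add_frac hb hb' one_ne_zero⟩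
  neg_mem' := by
    rintro _ ⟨a, b, hb, rfl⟩
    exact ⟨-a, b, hb, neg_frac a b _ _⟩

/-- The summands of the partial fraction decomposition with respect to `z`. -/
def part : Option (Pole F) → AddSubgroup (RatFun F)
  | none => polynomialPart F
  | some i => i.part

/-- The fractions with a pole of order at most `j` at the prime `d`. -/
def poleOrderLE {d : Poly F} (hd : Prime d) (j : ℕ) : AddSubgroup (RatFun F) where
  carrier := {x | ∃ a s, ¬ d ∣ s ∧ x * (toRat s * toRat d ^ j) = toRat a}
  zero_mem' := ⟨0, 1, fun h => hd.not_isUnit (isUnit_of_dvd_one h), by simp⟩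
  add_mem' := by
    rintro x y ⟨a, s, hs, hx⟩ ⟨a', s', hs', hy⟩
    refine ⟨a * s' + a' * s, s * s', fun h => (hd.dvd_or_dvd h).elim hs hs', ?_⟩
    simp only [toRat, map_add, map_mul] at *
    linear_combination (algebraMap (Poly F) (RatFun F) s') * hx +
      (algebraMap (Poly F) (RatFun F) s) * hy
  neg_mem' := by
    rintro x ⟨a, s, hs, hx⟩
    exact ⟨-a, s, hs, by rw [neg_mul, hx, ← map_neg]⟩

theorem poleOrderLE_mono {d : Poly F} (hd : Prime d) {j k : ℕ} (h : j ≤ k) :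
    poleOrderLE hd j ≤ poleOrderLE hd k := by
  rintro x ⟨a, s, hs, hx⟩
  refine ⟨a * d ^ (k - j), s, hs, ?_⟩
  rw [← Nat.sub_add_cancel h]
  simp only [toRat, map_mul, map_pow, Nat.add_sub_cancel] at *
  rw [← hx]
  ring

theorem not_dvd_C {d : Poly F} (hd : 0 < d.degree) {b : F[X]} (hb : b ≠ 0) : ¬ d ∣ C b := by
  intro h
  have := degree_le_of_dvd h (C_ne_zero.2 hb)
  rw [degree_C hb] at this
  exact absurd hd (not_lt.2 this)

/-- The units of `F[y, z]` are the nonzero constants of `F`, so the normalization leaves one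
representative in each class of associates. -/
theorem eq_of_dvd_of_isLexMonic {d d' : Poly F} (hd : IsLexMonic d) (hd' : IsLexMonic d')
    (hi : Irreducible d) (hi' : Irreducible d') (h : d ∣ d') : d = d' := by
  obtain ⟨u, rfl⟩ := hi.associated_of_dvd hi' h
  obtain ⟨p, hp, hpu⟩ := isUnit_iff.1 u.isUnit
  obtain ⟨c, hc, rfl⟩ := isUnit_iff.1 hp
  rw [IsLexMonic, ← hpu, leadingCoeff_mul, leadingCoeff_mul, leadingCoeff_C, leadingCoeff_C,
    hd, one_mul] at hd'
  simp [← hpu, hd']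

theorem frac_mem_poleOrderLE {d : Poly F} (hd : Prime d) {a : Poly F} {b : F[X]} {e : Poly F}
    {j : ℕ} (he : e ≠ 0) (hb : b ≠ 0) (h : ¬ d ∣ C b * e ^ j) :
    frac a b e j ∈ poleOrderLE hd 0 := by
  refine ⟨a, C b * e ^ j, h, ?_⟩
  have h1 : toRat (C b) ≠ 0 := by simpa using hb
  have h2 : toRat e ≠ 0 := by simpa using he
  simp only [frac, toRat, map_mul, map_pow, pow_zero, mul_one] at *
  field_simp

theorem Pole.prime (i : Pole F) : Prime i.poly := i.irreducible.prime

theorem part_le_of_ne (i : Pole F) (k : Option (Pole F))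
    (h : ∀ i', k = some i' → i'.poly ≠ i.poly) : part k ≤ poleOrderLE i.prime 0 := by
  cases k with
  | none =>
    rintro _ ⟨a, b, hb, rfl⟩
    exact frac_mem_poleOrderLE _ one_ne_zero hb (by simpa using not_dvd_C i.degree_pos hb)
  | some i' =>
    rintro _ ⟨a, b, hb, -, rfl⟩
    refine frac_mem_poleOrderLE _ i'.irreducible.ne_zero hb fun hdvd => ?_
    rcases i.prime.dvd_or_dvd hdvd with h1 | h1
    · exact not_dvd_C i.degree_pos hb h1
    · exact h i' rfl (eq_of_dvd_of_isLexMonic i.lexMonic i'.lexMonic i.irreducible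
        i'.irreducible (i.prime.dvd_of_dvd_pow h1)).symm

theorem Pole.part_le (i i' : Pole F) (h : i'.poly = i.poly) :
    i'.part ≤ poleOrderLE i.prime i'.order := by
  rintro _ ⟨a, b, hb, -, rfl⟩
  refine ⟨a, C b, not_dvd_C i.degree_pos hb, ?_⟩
  rw [h]
  have h1 : toRat (C b) ≠ 0 := by simpa using hb
  have h2 : toRat i.poly ≠ 0 := by simpa using i.irreducible.ne_zero
  simp only [frac]
  field_simp

/-- A nonzero numerator of smaller `z`-degree is not divisible by the prime `d`, so the order of the
pole is exact. -/
theorem Pole.eq_zero_of_mem (i : Pole F) {x : RatFun F} (hx : x ∈ i.part)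
    (hx' : x ∈ poleOrderLE i.prime (i.order - 1)) : x = 0 := by
  obtain ⟨a, b, hb, ha, rfl⟩ := hx
  obtain ⟨a', s, hs, h⟩ := hx'
  have h1 : toRat (C b) ≠ 0 := by simpa using hb
  have h2 : toRat i.poly ≠ 0 := by simpa using i.irreducible.ne_zero
  have key : a * s = i.poly * (a' * C b) := by
    apply toRat_injective
    have hj : toRat i.poly ^ i.order = toRat i.poly ^ (i.order - 1) * toRat i.poly := by
      rw [← pow_succ, Nat.sub_add_cancel i.order_pos]
    rw [frac, hj] at h
    simp only [toRat, map_mul] at *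
    rw [← h]
    field_simp
  rcases i.prime.dvd_or_dvd (Dvd.intro _ key.symm) with h3 | h3
  · have : a = 0 := eq_zero_of_dvd_of_degree_lt h3 ha
    simp [this, frac]
  · exact absurd h3 hs

/-- Pseudo-dividing the numerator by `d` splits off the term of highest order; the quotient has
order one less. -/
theorem frac_mem_iSup_part {d : Poly F} (hm : IsLexMonic d) (hd : Irreducible d)
    (hdeg : 0 < d.degree) (j : ℕ) : ∀ (a : Poly F) {b : F[X]}, b ≠ 0 →
    frac a b d j ∈ ⨆ k : Option (Pole F), part k := by
  induction j with
  | zero =>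
    intro a b hb
    exact AddSubgroup.mem_iSup_of_mem none ⟨a, b, hb, by simp [frac]⟩
  | succ j ih =>
    intro a b hb
    obtain ⟨c, hc, q, r, hq, hr⟩ := exists_C_mul_eq_mul_add hd.ne_zero a
    have : frac a b d (j + 1) = frac q (c * b) d j + frac r (c * b) d (j + 1) := by
      have h0 : toRat (C b) ≠ 0 := by simpa using hb
      have h1 : toRat (C c) ≠ 0 := by simpa using hc
      have h2 : toRat d ≠ 0 := by simpa using hd.ne_zero
      have h3 := congrArg toRat hq
      simp only [frac, toRat, map_add, map_mul] at *
      field_simp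
      linear_combination (algebraMap (Poly F) (RatFun F) d) ^ j * h3
    rw [this]
    exact add_mem (ih q (mul_ne_zero hc hb)) (AddSubgroup.mem_iSup_of_mem
      (some ⟨d, j + 1, hm, hd, hdeg, j.succ_pos⟩) ⟨r, c * b, mul_ne_zero hc hb, hr, rfl⟩)

theorem exists_isLexMonic {p : Poly F} (hp : p ≠ 0) :
    ∃ c : F, c ≠ 0 ∧ ∃ d, IsLexMonic d ∧ p = C (C c) * d := by
  have hc : p.leadingCoeff.leadingCoeff ≠ 0 := by simpa using hp
  refine ⟨_, hc, C (C (p.leadingCoeff.leadingCoeff)⁻¹) * p, ?_, ?_⟩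
  · simp [IsLexMonic, hp]
  · rw [← mul_assoc, ← C_mul, ← C_mul, mul_inv_cancel₀ hc]
    simp

/-- Coprime factors of the denominator are separated by a Bézout relation whose right side is a
constant in `F[y]`; that constant is absorbed into `b`. -/
theorem frac_mem_iSup_part_of_ne_zero (q : Poly F) : q ≠ 0 → ∀ (a : Poly F) {b : F[X]}, b ≠ 0 →
    frac a b q 1 ∈ ⨆ k : Option (Pole F), part k := by
  have hconst : ∀ (p : F[X]), p ≠ 0 → ∀ (a : Poly F) {b : F[X]}, b ≠ 0 →
      frac a b (C p) 1 ∈ ⨆ k : Option (Pole F), part k := fun p hp a b hb =>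
    AddSubgroup.mem_iSup_of_mem none ⟨a, b * p, mul_ne_zero hb hp, by simp [frac]⟩
  induction q using UniqueFactorizationMonoid.induction_on_coprime with
  | h0 => exact fun h => absurd rfl h
  | h1 hq =>
    obtain ⟨p, hp, rfl⟩ := isUnit_iff.1 hq
    exact fun _ => hconst p hp.ne_zero
  | @hpr p i hp =>
    intro hpi a b hb
    by_cases hdeg : 0 < p.degree
    · obtain ⟨c, hc, d, hd, rfl⟩ := exists_isLexMonic hp.ne_zero
      have hu : IsUnit (C (C c) : Poly F) := isUnit_C.2 (isUnit_C.2 hc.isUnit)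
      have h := frac_mem_iSup_part hd ((irreducible_isUnit_mul hu).1 hp.irreducible)
        (by rwa [degree_C_mul (C_ne_zero.2 hc)] at hdeg) i a
        (mul_ne_zero hb (pow_ne_zero i (C_ne_zero.2 hc)))
      convert h using 1
      simp only [frac, toRat, map_mul, map_pow, mul_pow]
      ring
    · rw [eq_C_of_degree_le_zero (not_lt.1 hdeg)] at hp hpi ⊢
      rw [← C_pow] at hpi ⊢
      exact hconst _ (by simpa using hpi) a hb
  | @hcp x y hxy hx hy =>
    intro h a b hb
    have hx0 := left_ne_zero_of_mul h
    have hy0 := right_ne_zero_of_mul h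
    obtain ⟨c, hc, u, v, huv⟩ := exists_mul_add_mul_eq_C hxy
    have : frac a b (x * y) 1 = frac (a * u) (c * b) y 1 + frac (a * v) (c * b) x 1 := by
      have h0 : toRat (C b) ≠ 0 := by simpa using hb
      have h1 : toRat (C c) ≠ 0 := by simpa using hc
      have h2 : toRat x ≠ 0 := by simpa using hx0
      have h3 : toRat y ≠ 0 := by simpa using hy0
      have h4 := congrArg toRat huv
      simp only [frac, toRat, map_add, map_mul] at *
      field_simp
      linear_combination -(algebraMap (Poly F) (RatFun F) a) * h4
    rw [this]
    exact add_mem (hy hy0 _ (mul_ne_zero hc hb)) (hx hx0 _ (mul_ne_zero hc hb))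

/-- For independence, take a nonzero term of maximal order at a given `d` in a vanishing sum. All
other terms have smaller order at `d`, contradicting `Pole.eq_zero_of_mem`. -/
theorem isInternal_part [DecidableEq (Option (Pole F))] :
    DirectSum.IsInternal (part : Option (Pole F) → AddSubgroup (RatFun F)) := by
  classical
  constructor
  · rw [injective_iff_map_eq_zero]
    intro x hx
    rw [DirectSum.coeAddMonoidHom_eq_dfinsuppSum, DFinsupp.sum] at hx
    have hpole : ∀ i : Pole F, x (some i) = 0 := by
      by_contra! h
      obtain ⟨i₀, hi₀⟩ := h
      obtain ⟨i, hi, hmax⟩ :=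
        (x.support.eraseNone.filter fun i => i.poly = i₀.poly).exists_max_image Pole.order ⟨i₀, by simpa using hi₀⟩
      simp only [Finset.mem_filter, Finset.mem_eraseNone, DFinsupp.mem_support_toFun] at hi hmax
      apply hi.1
      ext
      refine i.eq_zero_of_mem (x (some i)).2 ?_
      rw [← Finset.add_sum_erase _ _ (DFinsupp.mem_support_toFun _ _ |>.2 hi.1)] at hx
      rw [eq_neg_of_add_eq_zero_left hx]
      refine neg_mem (sum_mem fun k hk => ?_)
      rw [Finset.mem_erase, DFinsupp.mem_support_toFun] at hk
      by_cases hk' : ∃ i', k = some i' ∧ i'.poly = i.poly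
      · obtain ⟨i', rfl, hi'⟩ := hk'
        have hlt : i'.order < i.order := by
          refine lt_of_le_of_ne (hmax i' ⟨hk.2, hi'.trans hi.2⟩) fun h => hk.1 ?_
          rw [Pole.ext hi' h]
        exact poleOrderLE_mono _ (by omega) (i.part_le i' hi' (x (some i')).2)
      · push Not at hk'
        exact poleOrderLE_mono _ (Nat.zero_le _) (part_le_of_ne i k hk' (x k).2)
    have hnone : (x none : RatFun F) = 0 := by
      rw [← hx]
      refine (Finset.sum_eq_single (f := fun k => (x k : RatFun F)) none ?_ ?_).symm
      · rintro (_ | i) - h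
        · exact absurd rfl h
        · simp [hpole i]
      · intro h
        simpa using h
    ext k
    cases k with
    | none => simpa using hnone
    | some i => simp [hpole i]
  · intro x
    obtain ⟨a, q, hq, rfl⟩ := IsFractionRing.div_surjective (A := Poly F) x
    have h := frac_mem_iSup_part_of_ne_zero q (nonZeroDivisors.ne_zero hq) a one_ne_zero
    have hle : ⨆ k : Option (Pole F), part k ≤
        (DirectSum.coeAddMonoidHom (part : Option (Pole F) → AddSubgroup (RatFun F))).range :=
      iSup_le fun k v hv => ⟨DirectSum.of (fun k => part k) k ⟨v, hv⟩,
        DirectSum.coeAddMonoidHom_of part k ⟨v, hv⟩⟩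
    simpa [frac] using hle h

/-! ### The group of shifts and its action on poles -/

theorem ringHom_ext {A : Type*} [CommSemiring A] {f g : Poly F →+* A}
    (hc : ∀ c : F, f (C (C c)) = g (C (C c))) (hy : f (C X) = g (C X)) (hz : f X = g X) :
    f = g := by
  refine Polynomial.ringHom_ext (fun p => ?_) hz
  exact congrArg (fun φ : F[X] →+* A => φ p)
    (Polynomial.ringHom_ext (f := f.comp C) (g := g.comp C) hc hy)

theorem algHom_ext {A : Type*} [CommSemiring A] [Algebra F A] {f g : Poly F →ₐ[F] A}
    (hy : f (C X) = g (C X)) (hz : f X = g X) : f = g :=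
  AlgHom.coe_ringHom_injective
    (ringHom_ext (fun c => (f.commutes c).trans (g.commutes c).symm) hy hz)

theorem _root_.RingAut.zpow_apply_eq_add {R : Type*} [Ring R] {τ : RingAut R} {x : R} {s : R}
    (h : τ x = x + s) (hs : τ s = s) (m : ℤ) : (τ ^ m) x = x + m * s := by
  have hinv : τ⁻¹ x = x - s := by
    rw [RingAut.inv_apply, RingEquiv.symm_apply_eq, map_sub, h, hs, add_sub_cancel_right]
  have hinv' : τ⁻¹ s = s := by
    rw [RingAut.inv_apply, RingEquiv.symm_apply_eq, hs]
  induction m with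
  | zero => simp
  | succ k ih =>
    rw [zpow_add_one, zpow_natCast] at *
    rw [RingAut.mul_apply, h, map_add, ih]
    have : (τ ^ k) s = s := by
      rw [RingAut.coe_pow]
      exact Function.iterate_fixed hs k
    rw [this]
    push_cast
    rw [add_mul, one_mul, add_assoc]
  | pred k ih =>
    rw [zpow_sub_one, RingAut.mul_apply, hinv, map_sub, ih]
    have : (τ ^ (-(k : ℤ))) s = s := by
      rw [zpow_neg, zpow_natCast, ← inv_pow, RingAut.coe_pow]
      exact Function.iterate_fixed hinv' k
    rw [this]
    push_cast
    rw [sub_mul, one_mul, add_sub_assoc]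

theorem _root_.RingAut.zpow_apply_eq_self {R : Type*} [Ring R] {τ : RingAut R} {x : R}
    (h : τ x = x) (m : ℤ) : (τ ^ m) x = x := by
  simpa using RingAut.zpow_apply_eq_add (s := 0) (by simpa using h) (map_zero τ) m

theorem shiftY_C (p : F[X]) : shiftY (C p) = C (p.comp (X + C 1)) := by
  simp [shiftY, algEquivAevalXAddC, aeval_def, comp, eval₂_eq_eval_map]

theorem shiftY_X : shiftY (X : Poly F) = X := by
  simp [shiftY]

theorem shiftZ_C (p : F[X]) : shiftZ (C p) = C p := by
  simp [shiftZ]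

theorem shiftZ_X : shiftZ (X : Poly F) = X + 1 := by
  simp [shiftZ]

/-- The translation `p(y, z) ↦ p(y + s, z + t)`. -/
abbrev translate (s t : Poly F) : Poly F →ₐ[F] Poly F := aevalAeval (C X + s) (X + t)

/-- As substitutions, shifts make sense for non-integer amounts too, which `translate_eq_self`
exploits. -/
theorem shift_apply (m n : ℤ) (p : Poly F) :
    (shiftY ^ m * shiftZ ^ n : RingAut (Poly F)) p = translate (m : Poly F) (n : Poly F) p := by
  have hY1 : shiftY (1 : Poly F) = 1 := map_one _
  have hZ1 : shiftZ (1 : Poly F) = 1 := map_one _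
  suffices h : ((shiftY ^ m * shiftZ ^ n : RingAut (Poly F)) : Poly F →+* Poly F) =
      (translate (m : Poly F) (n : Poly F) : Poly F →+* Poly F) from
    congrArg (fun f : Poly F →+* Poly F => f p) h
  refine ringHom_ext (fun c => ?_) ?_ ?_
  · change (shiftY ^ m) ((shiftZ ^ n) _) = (translate (m : Poly F) (n : Poly F)) (C (C c))
    rw [RingAut.zpow_apply_eq_self (shiftZ_C _),
      RingAut.zpow_apply_eq_self (by simp [shiftY_C]), aevalAeval_C, aeval_C]
    rfl
  · change (shiftY ^ m) ((shiftZ ^ n) _) = (translate (m : Poly F) (n : Poly F)) (C X)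
    rw [RingAut.zpow_apply_eq_self (shiftZ_C _),
      RingAut.zpow_apply_eq_add (s := 1) (by simp [shiftY_C]) hY1, aevalAeval_X, mul_one]
  · change (shiftY ^ m) ((shiftZ ^ n) _) = (translate (m : Poly F) (n : Poly F)) X
    rw [RingAut.zpow_apply_eq_add shiftZ_X hZ1, map_add,
      RingAut.zpow_apply_eq_self shiftY_X, mul_one, map_intCast, aevalAeval_Y]

theorem translate_translate (m n m' n' : ℤ) (p : Poly F) :
    translate (m : Poly F) (n : Poly F) (translate (m' : Poly F) (n' : Poly F) p) =
      translate ((m + m' : ℤ) : Poly F) ((n + n' : ℤ) : Poly F) p := by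
  rw [← AlgHom.comp_apply]
  congr 1
  refine algHom_ext ?_ ?_
  · simp only [AlgHom.comp_apply, aevalAeval_X, map_add, map_intCast]
    push_cast
    ring
  · simp only [AlgHom.comp_apply, aevalAeval_Y, map_add, map_intCast]
    push_cast
    ring

variable (F) in
/-- The automorphisms `σ_y^m σ_z^n` of `F[y, z]`. -/
def shiftGroup : Subgroup (RingAut (Poly F)) where
  carrier := {τ | ∃ m n : ℤ, τ = shiftY ^ m * shiftZ ^ n}
  one_mem' := ⟨0, 0, by simp⟩
  mul_mem' := by
    rintro _ _ ⟨m, n, rfl⟩ ⟨m', n', rfl⟩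
    refine ⟨m + m', n + n', RingEquiv.ext fun p => ?_⟩
    rw [RingAut.mul_apply, shift_apply, shift_apply, shift_apply, translate_translate]
  inv_mem' := by
    rintro _ ⟨m, n, rfl⟩
    refine ⟨-m, -n, inv_eq_of_mul_eq_one_left (RingEquiv.ext fun p => ?_)⟩
    rw [RingAut.mul_apply, shift_apply, shift_apply, translate_translate, RingAut.one_apply]
    simpa using (shift_apply 0 0 p).symm

theorem shift_mul_shift (m n m' n' : ℤ) :
    (shiftY ^ m * shiftZ ^ n * (shiftY ^ m' * shiftZ ^ n') : RingAut (Poly F)) =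
      shiftY ^ (m + m') * shiftZ ^ (n + n') := by
  refine RingEquiv.ext fun p => ?_
  rw [RingAut.mul_apply, shift_apply, shift_apply, shift_apply, translate_translate]

theorem shift_zpow (m n k : ℤ) :
    (shiftY ^ m * shiftZ ^ n : RingAut (Poly F)) ^ k = shiftY ^ (k * m) * shiftZ ^ (k * n) := by
  have hc : Commute (shiftY : RingAut (Poly F)) shiftZ := by
    have h1 := shift_mul_shift (F := F) 0 1 1 0
    exact (by simpa using h1.symm : shiftY * shiftZ = shiftZ * shiftY)
  rw [(hc.zpow_zpow m n).mul_zpow, ← zpow_mul, ← zpow_mul, mul_comm m, mul_comm n]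

variable (F) in
/-- The automorphisms of `F[y, z]` which preserve the degree in `z` and the coefficient of the
highest term. -/
def lexGroup : Subgroup (RingAut (Poly F)) where
  carrier := {τ | ∀ p, (τ p).degree = p.degree ∧
    (τ p).leadingCoeff.leadingCoeff = p.leadingCoeff.leadingCoeff}
  one_mem' := fun p => ⟨rfl, rfl⟩
  mul_mem' := by
    intro τ τ' h h' p
    rw [RingAut.mul_apply]
    exact ⟨(h _).1.trans (h' p).1, (h _).2.trans (h' p).2⟩
  inv_mem' := by
    intro τ h p
    have := h (τ⁻¹ p)
    rw [← RingAut.mul_apply, mul_inv_cancel, RingAut.one_apply] at this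
    exact ⟨this.1.symm, this.2.symm⟩

theorem shiftGroup_le_lexGroup : shiftGroup F ≤ lexGroup F := by
  rintro _ ⟨m, n, rfl⟩
  refine mul_mem (zpow_mem ?_ m) (zpow_mem ?_ n)
  · intro p
    have : shiftY p = p.map (algEquivAevalXAddC (1 : F)).toRingEquiv.toRingHom := rfl
    have hinj : Function.Injective (algEquivAevalXAddC (1 : F)).toRingEquiv.toRingHom :=
      (algEquivAevalXAddC (1 : F)).injective
    rw [this, degree_map_eq_of_injective hinj, leadingCoeff_map_of_injective hinj]
    refine ⟨rfl, ?_⟩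
    change (aeval (X + C 1 : F[X]) p.leadingCoeff).leadingCoeff = _
    rw [← comp_eq_aeval, ← taylor_apply, leadingCoeff_taylor]
  · intro p
    have : shiftZ p = p.comp (X + C 1) := by rw [comp_eq_aeval]; rfl
    rw [this, ← taylor_apply, degree_taylor, leadingCoeff_taylor]
    exact ⟨rfl, rfl⟩

theorem shiftGroup_apply_C (g : shiftGroup F) {b : F[X]} (hb : b ≠ 0) :
    ∃ b' : F[X], b' ≠ 0 ∧ g.1 (C b) = C b' := by
  have h := (shiftGroup_le_lexGroup g.2 (C b)).1
  rw [degree_C hb] at h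
  have h' := eq_C_of_degree_le_zero h.le
  refine ⟨_, fun h0 => ?_, h'⟩
  rw [h0, C_0] at h'
  simp [h'] at h

/-- Shifts preserve the lexicographic normalization, so they permute the chosen representatives
themselves, not just their classes. -/
instance : MulAction (shiftGroup F) (Pole F) where
  smul g i :=
    { poly := g.1 i.poly
      order := i.order
      lexMonic := (shiftGroup_le_lexGroup g.2 i.poly).2.trans i.lexMonic
      irreducible := (MulEquiv.irreducible_iff g.1).2 i.irreducible
      degree_pos := i.degree_pos.trans_eq (shiftGroup_le_lexGroup g.2 i.poly).1.symm
      order_pos := i.order_pos }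
  one_smul _ := rfl
  mul_smul _ _ _ := rfl

@[simp] theorem smul_pole_poly (g : shiftGroup F) (i : Pole F) : (g • i).poly = g.1 i.poly := rfl

instance : DistribMulAction (shiftGroup F) (RatFun F) :=
  DistribMulAction.compHom (RatFun F)
    ((IsFractionRing.ringEquivOfRingEquivHom (Poly F) (RatFun F)).comp (shiftGroup F).subtype)

theorem smul_def (g : shiftGroup F) (x : RatFun F) : g • x = extend g.1 x := rfl

theorem extend_toRat (τ : RingAut (Poly F)) (p : Poly F) : extend τ (toRat p) = toRat (τ p) :=
  IsFractionRing.ringEquivOfRingEquiv_algebraMap τ p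

theorem smul_frac (g : shiftGroup F) (a : Poly F) {b b' : F[X]} (hb : g.1 (C b) = C b')
    (d : Poly F) (j : ℕ) : g • frac a b d j = frac (g.1 a) b' (g.1 d) j := by
  rw [smul_def, frac, map_div₀, map_mul, map_pow, extend_toRat, extend_toRat, extend_toRat, hb,
    frac]

theorem smul_mem_part (g : shiftGroup F) (k : Option (Pole F)) :
    ∀ v ∈ part k, g • v ∈ part (g • k) := by
  cases k with
  | none =>
    rintro _ ⟨a, b, hb, rfl⟩
    obtain ⟨b', hb', h⟩ := shiftGroup_apply_C g hb
    exact ⟨g.1 a, b', hb', by rw [smul_frac g a h, map_one]⟩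
  | some i =>
    rintro _ ⟨a, b, hb, ha, rfl⟩
    obtain ⟨b', hb', h⟩ := shiftGroup_apply_C g hb
    refine ⟨g.1 a, b', hb', ?_, smul_frac g a h _ _⟩
    rwa [smul_pole_poly, (shiftGroup_le_lexGroup g.2 _).1, (shiftGroup_le_lexGroup g.2 _).1]

/-! ### Stabilizers and integer linear polynomials -/

theorem aevalAeval_C_X_zero (d : Poly F) :
    aevalAeval (C X : Poly F) 0 d = C (d.coeff 0) := by
  have : aevalAeval (C X : Poly F) (0 : Poly F) =
      (CAlgHom : F[X] →ₐ[F] Poly F).comp ((aeval (R := F[X]) (0 : F[X])).restrictScalars F) :=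
    algHom_ext (by simp) (by simp)
  rw [this]
  simp [coeff_zero_eq_eval_zero]

theorem aevalAeval_zero (u : Poly F) (d : Poly F) :
    aevalAeval (0 : Poly F) u d = aeval u (aevalAeval (0 : F[X]) X d) := by
  rw [← AlgHom.comp_apply]
  congr 1
  exact algHom_ext (by simp) (by simp)

theorem translate_linForm (m n α β : ℤ) :
    translate (m : Poly F) (n : Poly F) (linForm α β) =
      linForm α β + C (C ((α * m + β * n : ℤ) : F)) := by
  have h : (C (C ((α * m + β * n : ℤ) : F)) : Poly F) = ((α * m + β * n : ℤ) : Poly F) := by simp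
  rw [h, linForm, map_add, map_mul, map_mul, aevalAeval_X, aevalAeval_Y, map_intCast, map_intCast]
  push_cast
  ring

theorem translate_C (m n : ℤ) (p : F[X]) :
    translate (m : Poly F) (n : Poly F) (C p) = C (p.comp (X + C (m : F))) := by
  have h : (CAlgHom : F[X] →ₐ[F] Poly F) (X + C (m : F)) = C X + (m : Poly F) := by simp
  rw [aevalAeval_C, comp_eq_aeval, ← h]
  exact aeval_algHom_apply CAlgHom _ p

theorem shift_isIntegerLinear_eq_self {d : Poly F} {α β : ℤ} (h : IsIntegerLinearOfType d α β) :
    (shiftY ^ β * shiftZ ^ (-α) : RingAut (Poly F)) d = d := by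
  obtain ⟨-, -, p, rfl⟩ := h
  rw [shift_apply, ← aeval_algHom_apply, translate_linForm]
  simp [mul_comm]

/-- Freeness in the form required by `Polynomial.eq_zero_of_mul_comp_eq`. -/
theorem IsFree.isRelPrime_comp {b : F[X]} {β : ℤ} (h : IsFree (shiftY ^ β) (C b)) {k : ℕ}
    (hk : k ≠ 0) : IsRelPrime b (b.comp (X + C (k * (β : F)))) := by
  intro q h1 h2
  have h3 : (((shiftY : RingAut (Poly F)) ^ β) ^ (k : ℤ)) (C b) =
      C (b.comp (X + C (k * (β : F)))) := by
    rw [← zpow_mul]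
    have := shift_apply (β * k) 0 (C b)
    rw [translate_C, zpow_zero, mul_one] at this
    rw [this]
    congr 4
    push_cast
    ring
  have h4 := h k (by exact_mod_cast hk)
  rw [h3] at h4
  exact isUnit_C.1 (h4 (map_dvd C h1) (map_dvd C h2))

/-- The pole of a remainder fraction. -/
def IsRemainderFraction.pole {a d : Poly F} {b : F[X]} {j : ℕ}
    (h : IsRemainderFraction a b d j) : Pole F :=
  ⟨d, j, h.monic, h.irreducible, h.degree_pos, h.pos⟩

theorem IsRemainderFraction.mem_part {a d : Poly F} {b : F[X]} {j : ℕ}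
    (h : IsRemainderFraction a b d j) : frac a b d j ∈ h.pole.part :=
  ⟨a, b, h.denom_ne_zero, h.degree_lt, rfl⟩

/-- For `β = 0` the polynomial would lie in `F[y]`. -/
theorem pos_of_isIntegerLinearOfType {d : Poly F} (hd : 0 < d.degree) {α β : ℤ}
    (h : IsIntegerLinearOfType d α β) : 0 < β := by
  obtain ⟨-, hβ, p, rfl⟩ := h
  refine lt_of_le_of_ne hβ fun h0 => ?_
  subst h0
  have : aeval (linForm α 0) p = (CAlgHom : F[X] →ₐ[F] Poly F) (aeval ((α : F[X]) * X) p) := by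
    rw [← aeval_algHom_apply]
    simp [linForm]
  rw [this] at hd
  exact absurd hd (not_lt.2 degree_C_le)

variable [CharZero F]

/-- A polynomial fixed by a shift is fixed by all translations in the same direction. -/
theorem translate_eq_self {d : Poly F} {m n : ℤ}
    (h : (shiftY ^ m * shiftZ ^ n : RingAut (Poly F)) d = d) (x : Poly F) :
    translate ((m : Poly F) * x) ((n : Poly F) * x) d = d := by
  -- `P(t) = d(y + m t, z + n t) - d` in a new variable `t`. Powers of the shift make every natural
  -- number a root, so `P = 0` in characteristic zero.
  let P : (Poly F)[X] :=
    aevalAeval (C (C X) + (m : (Poly F)[X]) * X) (C X + (n : (Poly F)[X]) * X) d - C d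
  have hP : ∀ x : Poly F, P.eval x = translate ((m : Poly F) * x) ((n : Poly F) * x) d - d := by
    intro x
    have : ((aeval (R := Poly F) x).restrictScalars F).comp (aevalAeval
        (C (C X) + (m : (Poly F)[X]) * X) (C X + (n : (Poly F)[X]) * X)) =
        translate ((m : Poly F) * x) ((n : Poly F) * x) :=
      algHom_ext (by simp) (by simp)
    rw [← this]
    simp [P, aeval_def, eval₂_eq_eval_map]
  have hroot : ∀ k : ℕ, P.IsRoot (k : Poly F) := by
    intro k
    have hk : ((shiftY ^ m * shiftZ ^ n : RingAut (Poly F)) ^ (k : ℤ)) d = d :=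
      RingAut.zpow_apply_eq_self h k
    rw [shift_zpow, shift_apply] at hk
    rw [IsRoot.def, hP, sub_eq_zero]
    convert hk using 3 <;> (push_cast; ring)
  have h0 : P = 0 := eq_zero_of_infinite_isRoot P
    (Set.infinite_of_injective_forall_mem Nat.cast_injective hroot)
  rw [← sub_eq_zero, ← hP, h0, eval_zero]

/-- A polynomial of positive degree in `z` which is fixed by a nontrivial shift is integer
linear. -/
theorem exists_isIntegerLinearOfType {d : Poly F} (hd : 0 < d.degree) {m n : ℤ}
    (h : (shiftY ^ m * shiftZ ^ n : RingAut (Poly F)) d = d) (hmn : ¬ (m = 0 ∧ n = 0)) :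
    ∃ α β : ℤ, IsIntegerLinearOfType d α β := by
  have hC : ∀ {c : F}, c ≠ 0 → (C (C c) * C (C c⁻¹) : Poly F) = 1 := by
    intro c hc
    rw [← C_mul, ← C_mul, mul_inv_cancel₀ hc, C_1, C_1]
  by_cases hm : m = 0
  · exfalso
    subst hm
    have hn : (n : F) ≠ 0 := by
      simpa using hmn
    -- Translating by `-z / n` times `(0, n)` moves `z` to `0`, so `d = d(y, 0)` has no `z`.
    have h1 := translate_eq_self h (-(C (C (n : F)⁻¹) * X : Poly F))
    have h2 : (n : Poly F) * -(C (C (n : F)⁻¹) * X : Poly F) = -X := by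
      have : (n : Poly F) = C (C (n : F)) := by simp
      rw [this]
      linear_combination -X * hC hn
    rw [h2, translate, Int.cast_zero, zero_mul, add_zero, add_neg_cancel, aevalAeval_C_X_zero] at h1
    rw [← h1] at hd
    exact absurd hd (not_lt.2 degree_C_le)
  · have hm' : (m : F) ≠ 0 := by exact_mod_cast hm
    let q : ℚ := (n : ℚ) / m
    have hq0 : (q.den : F) ≠ 0 := by exact_mod_cast q.den_ne_zero
    have hq : (n : F) / m = q.num / q.den := by
      have := congrArg (Rat.cast : ℚ → F) (Rat.num_div_den q).symm
      simpa [q] using this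
    -- Translating by `-y / m` times `(m, n)` gives `d = d(0, z - (n / m) y)`. Writing `n / m` in
    -- lowest terms yields `α = -q.num`, `β = q.den`.
    have h1 := translate_eq_self h (-(C (C (m : F)⁻¹) * C X : Poly F))
    have h2 : (m : Poly F) * -(C (C (m : F)⁻¹) * C X : Poly F) = -(C X : Poly F) := by
      have : (m : Poly F) = C (C (m : F)) := by simp
      rw [this]
      linear_combination -C X * hC hm'
    have h3 : (n : Poly F) * -(C (C (m : F)⁻¹) * C X : Poly F) =
        -(C (C ((q.num : F) / q.den)) * C X : Poly F) := by
      have : (n : Poly F) = C (C (n : F)) := by simp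
      rw [this, ← hq, div_eq_mul_inv, C_mul, C_mul]
      ring
    rw [h2, h3, translate, add_neg_cancel, aevalAeval_zero] at h1
    refine ⟨-q.num, q.den, ?_, Int.natCast_nonneg _, (aevalAeval (0 : F[X]) X d).comp
      (C (q.den : F)⁻¹ * X), ?_⟩
    · rw [IsCoprime.neg_left_iff, Int.isCoprime_iff_gcd_eq_one]
      exact q.reduced
    · rw [← h1]
      conv_rhs => rw [h1]
      rw [comp_eq_aeval, ← aeval_algHom_apply]
      congr 2
      have h4 : ∀ c : F, algebraMap F (Poly F) c = C (C c) := fun c => rfl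
      have h5 : (C (C (q.den : F)⁻¹) : Poly F) * ((q.den : ℤ) : Poly F) = 1 := by
        have : ((q.den : ℤ) : Poly F) = C (C (q.den : F)) := by simp
        rw [this, mul_comm, hC hq0]
      have h6 : ((-q.num : ℤ) : Poly F) = - C (C (q.num : F)) := by simp
      simp only [map_mul, aeval_C, aeval_X, linForm, h4, h6]
      rw [div_eq_mul_inv, mul_comm (q.num : F), C_mul, C_mul]
      linear_combination -X * h5

variable (F) in
/-- For `β ≠ 0`, the substitution `z ↦ α y + β z` is an automorphism of `F[y, z]`. -/
theorem exists_algEquiv_X_eq_linForm (α : ℤ) {β : ℤ} (hβ : β ≠ 0) :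
    ∃ e : Poly F ≃ₐ[F[X]] Poly F, e X = linForm α β := by
  have hβ' : (β : F) ≠ 0 := by exact_mod_cast hβ
  let _ : Invertible (β : F) := invertibleOfNonzero hβ'
  let _ : Invertible (C (β : F)) := Invertible.map C _
  refine ⟨algEquivCMulXAddC (C (β : F)) (C (α : F) * X), ?_⟩
  simp [linForm, add_comm]

/-- The shifts fixing an integer linear polynomial of `(α, β)`-type are the powers of
`σ_y^β σ_z^(-α)`. -/
theorem eq_zpow_of_isIntegerLinearOfType {d : Poly F} (hd : 0 < d.degree) {α β : ℤ}
    (h : IsIntegerLinearOfType d α β) {m n : ℤ}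
    (hmn : (shiftY ^ m * shiftZ ^ n : RingAut (Poly F)) d = d) :
    ∃ k : ℤ, (shiftY ^ m * shiftZ ^ n : RingAut (Poly F)) =
      (shiftY ^ β * shiftZ ^ (-α)) ^ k := by
  have hβ := pos_of_isIntegerLinearOfType hd h
  obtain ⟨hcop, -, p, rfl⟩ := h
  obtain ⟨e, he⟩ := exists_algEquiv_X_eq_linForm F α hβ.ne'
  have hinj : Function.Injective (aeval (linForm α β) : F[X] →ₐ[F] Poly F) := by
    have : (aeval (linForm α β) : F[X] →ₐ[F] Poly F) =
        (e.toAlgHom.restrictScalars F).comp (mapAlgHom (Algebra.ofId F F[X])) := by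
      refine Polynomial.algHom_ext ?_
      simpa using he.symm
    rw [this]
    exact e.injective.comp (map_injective _ (C_injective))
  -- The shift adds `α m + β n` to the linear form, and a nonconstant `p` has no nonzero period.
  have hs : α * m + β * n = 0 := by
    by_contra hs
    have hs' : ((α * m + β * n : ℤ) : F) ≠ 0 := by exact_mod_cast hs
    rw [shift_apply, ← aeval_algHom_apply, translate_linForm] at hmn
    have hp : p.comp (X + C ((α * m + β * n : ℤ) : F)) = p := by
      apply hinj
      rw [← hmn, comp_eq_aeval, ← aeval_algHom_apply]
      congr 2
      simp
    have := natDegree_eq_zero_of_comp_X_add_C_eq hs' hp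
    rw [eq_C_of_natDegree_eq_zero this, aeval_C] at hd
    exact absurd hd (not_lt.2 degree_C_le)
  obtain ⟨k, rfl⟩ : β ∣ m := hcop.symm.dvd_of_dvd_mul_left ⟨-n, by linear_combination hs⟩
  have hn : n = -(α * k) := by
    apply mul_left_cancel₀ hβ.ne'
    linear_combination hs
  refine ⟨k, ?_⟩
  rw [shift_zpow, hn]
  congr 2 <;> ring

/-! ### Remainder fractions in the coinvariants -/

/-- The numerator of a remainder fraction whose denominator is integer linear vanishes as soon as
the fraction is a difference with respect to `σ_y^β σ_z^(-α)`. -/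
theorem IsRemainderFraction.eq_zero_of_isIntegerLinearOfType {a d : Poly F} {b : F[X]} {j : ℕ}
    (h : IsRemainderFraction a b d j) {α β : ℤ} (hd : IsIntegerLinearOfType d α β)
    {a' : Poly F} {b' : F[X]} (hb' : b' ≠ 0)
    (heq : frac a b d j = frac ((shiftY ^ β * shiftZ ^ (-α) : RingAut (Poly F)) a')
      (b'.comp (X + C (β : F))) d j - frac a' b' d j) : a = 0 := by
  have hβ := pos_of_isIntegerLinearOfType h.degree_pos hd
  have hβ' : (β : F) ≠ 0 := by exact_mod_cast hβ.ne'
  obtain ⟨c, hc, hac⟩ := h.numer_of_integerLinear α β hd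
  obtain ⟨e, he⟩ := exists_algEquiv_X_eq_linForm F α hβ.ne'
  obtain ⟨A', rfl⟩ := e.surjective a'
  have heC : ∀ p : F[X], e (C p) = C p := e.commutes
  -- In the coordinates `y` and `w = α y + β z`, the shift acts on coefficients only, by `y ↦ y +
  -- β`.
  have hshift : ∀ p, (shiftY ^ β * shiftZ ^ (-α) : RingAut (Poly F)) (e p) =
      e (p.map (compRingHom (X + C (β : F)))) := by
    intro p
    rw [shift_apply]
    refine congrArg (fun f : Poly F →+* Poly F => f p) (ringHom_ext
      (f := ((translate (β : Poly F) ((-α : ℤ) : Poly F) : Poly F →+* Poly F)).comp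
        (e : Poly F →+* Poly F))
      (g := (e : Poly F →+* Poly F).comp (mapRingHom (compRingHom (X + C (β : F))))) ?_ ?_ ?_)
    · intro c
      change translate (β : Poly F) ((-α : ℤ) : Poly F) (e (C (C c))) = e ((C (C c)).map _)
      rw [map_C, heC, heC, translate_C]
      rfl
    · change translate (β : Poly F) ((-α : ℤ) : Poly F) (e (C X)) = e ((C X).map _)
      rw [map_C, heC, heC, translate_C]
      rfl
    · change translate (β : Poly F) ((-α : ℤ) : Poly F) (e X) = e (X.map _)
      rw [map_X, he, translate_linForm]
      simp [mul_comm]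
  have hcomp : b'.comp (X + C (β : F)) ≠ 0 := by
    rw [← taylor_apply]
    simpa using hb'
  let A : Poly F := ∑ i ∈ Finset.range (a.natDegree + 1), C (c i) * X ^ i
  have hA : e A = a := by
    rw [hac]
    simp only [A, map_sum, map_mul, map_pow, he, heC]
  have key : A * C (b' * b'.comp (X + C (β : F))) = C b *
      (A'.map (compRingHom (X + C (β : F))) * C b' - A' * C (b'.comp (X + C (β : F)))) := by
    apply e.injective
    apply toRat_injective
    rw [hshift] at heq
    have h0 : toRat (C b) ≠ 0 := by simpa using h.denom_ne_zero
    have h1 : toRat d ≠ 0 := by simpa using h.irreducible.ne_zero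
    have h2 : toRat (C b') ≠ 0 := by simpa using hb'
    have h3 : toRat (C (b'.comp (X + C (β : F)))) ≠ 0 := by
      rw [Ne, toRat_eq_zero, C_eq_zero]
      exact hcomp
    rw [C_mul]
    simp only [map_mul, map_sub, heC, hA]
    simp only [frac, toRat] at *
    generalize algebraMap (Poly F) (RatFun F) (C (b'.comp (X + C (β : F)))) = w at *
    field_simp at heq
    linear_combination heq
  -- Each power of `w` gives a separate univariate equation with the same `b` and `b'`.
  have hcoeff : ∀ i, A.coeff i = 0 := by
    intro i
    refine eq_zero_of_mul_comp_eq (c' := A'.coeff i) hβ'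
      (fun k hk => (h.denom_of_integerLinear α β hd).isRelPrime_comp hk) hb' ?_ ?_
    · simp only [A, finsetSum_coeff, coeff_C_mul_X_pow, Finset.sum_ite_eq, Finset.mem_range]
      split_ifs with hi
      · exact hc i (by omega)
      · rw [degree_zero, bot_lt_iff_ne_bot, Ne, degree_eq_bot]
        exact h.denom_ne_zero
    · have := congrArg (fun p : Poly F => p.coeff i) key
      simpa only [coeff_mul_C, coeff_C_mul, coeff_sub, coeff_map, coe_compRingHom_apply] using this
  rw [← hA, show A = 0 from Polynomial.ext hcoeff, map_zero]

/-- The coinvariants of the stabilizer of the pole of a nonzero remainder fraction detect this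
fraction. -/
theorem IsRemainderFraction.exists_addSubgroup {a d : Poly F} {b : F[X]} {j : ℕ}
    (h : IsRemainderFraction a b d j) :
    ∃ N : AddSubgroup (RatFun F),
      (∀ g : shiftGroup F, g • h.pole = h.pole → ∀ v ∈ h.pole.part, g • v - v ∈ N) ∧
      (frac a b d j ∈ N → frac a b d j = 0) := by
  have hfix : ∀ g : shiftGroup F, g • h.pole = h.pole → g.1 d = d := fun g hg =>
    congrArg Pole.poly hg
  by_cases hd : ∃ α β, IsIntegerLinearOfType d α β
  · obtain ⟨α, β, hd⟩ := hd
    let τ : shiftGroup F := ⟨shiftY ^ β * shiftZ ^ (-α), β, -α, rfl⟩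
    have hτ : τ • h.pole = h.pole := Pole.ext (shift_isIntegerLinear_eq_self hd) rfl
    have hpart : ∀ g : shiftGroup F, g • h.pole = h.pole → ∀ v ∈ h.pole.part,
        g • v ∈ h.pole.part := fun g hg v hv => by
      have := smul_mem_part g (some h.pole) v hv
      rwa [Option.smul_some, hg] at this
    -- The image of `τ - 1` suffices: `τ` generates the stabilizer, and `τ^k - 1` telescopes.
    let N := h.pole.part.map
      (DistribSMul.toAddMonoidHom (RatFun F) τ - AddMonoidHom.id (RatFun F))
    have hN : ∀ w ∈ h.pole.part, τ • w - w ∈ N := fun w hw => ⟨w, hw, rfl⟩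
    refine ⟨N, fun g hg v hv => ?_, ?_⟩
    · obtain ⟨k, rfl⟩ : ∃ k : ℤ, g = τ ^ k := by
        obtain ⟨_, m, n, rfl⟩ := g
        obtain ⟨k, hk⟩ := eq_zpow_of_isIntegerLinearOfType h.degree_pos hd (hfix _ hg)
        exact ⟨k, Subtype.ext hk⟩
      clear hg
      have hz : ∀ k : ℤ, τ ^ k • v ∈ h.pole.part := fun k =>
        hpart _ (zpow_mem (K := MulAction.stabilizer (shiftGroup F) h.pole) hτ k) v hv
      induction k with
      | zero => simp
      | succ k ih =>
        have := add_mem (hN _ (hz k)) ih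
        rwa [sub_add_sub_cancel, smul_smul, ← zpow_one_add, add_comm] at this
      | pred k ih =>
        have := sub_mem ih (hN _ (hz (-k - 1)))
        rwa [smul_smul, ← zpow_one_add, add_sub_cancel, sub_sub_sub_cancel_left] at this
    · rintro ⟨_, ⟨a', b', hb', -, rfl⟩, heq⟩
      have hC : τ.1 (C b') = C (b'.comp (X + C (β : F))) := by
        rw [← translate_C β (-α)]
        exact shift_apply _ _ _
      change τ • frac a' b' d j - frac a' b' d j = _ at heq
      rw [smul_frac τ a' hC, hfix τ hτ] at heq
      simp [frac, h.eq_zero_of_isIntegerLinearOfType hd hb' heq.symm]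
  -- Here the stabilizer is trivial, so nothing has to be divided out.
  · refine ⟨⊥, fun g hg v hv => ?_, fun h0 => h0⟩
    have h1 : g = 1 := by
      obtain ⟨_, m, n, rfl⟩ := g
      by_contra hne
      refine hd (exists_isIntegerLinearOfType h.degree_pos (hfix _ hg) fun h0 => hne ?_)
      exact Subtype.ext (by simp [h0.1, h0.2])
    simp [h1]

/-- An invariant functional which vanishes on summable functions and detects a given remainder
fraction. -/
theorem IsRemainderFraction.exists_functional {a d : Poly F} {b : F[X]} {j : ℕ}
    (h : IsRemainderFraction a b d j) :
    ∃ (N : AddSubgroup (RatFun F)) (φ : RatFun F →+ RatFun F ⧸ N),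
      (∀ f, IsSummable f → φ f = 0) ∧ (φ (frac a b d j) = 0 → frac a b d j = 0) ∧
      ∀ i : Pole F, (i.order = j → ¬ ShiftEquiv i.poly d) → ∀ v ∈ i.part, φ v = 0 := by
  classical
  obtain ⟨N, hN, hN'⟩ := h.exists_addSubgroup
  obtain ⟨φ, hinv, hself, hother⟩ := isInternal_part.exists_invariant_hom smul_mem_part
    (some h.pole) N (fun g hg => hN g (Option.some_injective _ hg))
  refine ⟨N, φ, ?_, fun h0 => hN' ?_, fun i hi v hv => hother (some i) ?_ v hv⟩
  · rintro _ ⟨g, g', rfl⟩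
    have h1 := hinv ⟨shiftY, 1, 0, by simp⟩ g
    have h2 := hinv ⟨shiftZ, 0, 1, by simp⟩ g'
    rw [smul_def] at h1 h2
    rw [map_add, map_sub, map_sub, sigmaY, sigmaZ, h1, h2, sub_self, sub_self, add_zero]
  · rw [hself _ h.mem_part] at h0
    exact (QuotientAddGroup.eq_zero_iff _).1 h0
  · rintro ⟨⟨_, m, n, rfl⟩, hg⟩
    have hg' := Option.some_injective _ hg
    exact hi (congrArg Pole.order hg').symm ⟨m, n, (congrArg Pole.poly hg').symm⟩

end BivSum

end

theorem mainTheorem5 {K : Type*} [Field K] [CharZero K]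
    (f r : BivSum.RatFun (RatFunc K)) (hr : BivSum.IsRemainder f r) (hr0 : r ≠ 0) :
    (∀ (m : ℕ) (n : Fin m → ℕ)
        (a : (i : Fin m) → Fin (n i) → BivSum.Poly (RatFunc K))
        (b : (i : Fin m) → Fin (n i) → Polynomial (RatFunc K))
        (d : Fin m → BivSum.Poly (RatFunc K)),
      BivSum.IsRemainderForm r m n a b d →
        ∀ (i : Fin m) (j : Fin (n i)),
          BivSum.frac (a i j) (b i j) (d i) (j + 1) ≠ 0 →
            ¬ BivSum.IsSummable (BivSum.frac (a i j) (b i j) (d i) (j + 1))) ∧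
      ¬ BivSum.IsSummable r := by
  have : CharZero (RatFunc K) := charZero_of_injective_algebraMap (algebraMap K _).injective
  refine ⟨fun m n a b d h i j hne hsum => ?_, fun hsum => ?_⟩
  · obtain ⟨N, φ, hφ, hφ', -⟩ := (h.remainderFraction i j).exists_functional
    exact hne (hφ' (hφ _ hsum))
  · obtain ⟨-, m, n, a, b, d, h⟩ := hr
    refine hr0 (h.eq_sum.trans (Finset.sum_eq_zero fun i _ => Finset.sum_eq_zero fun j _ => ?_))
    -- The functional of the fraction `(i, j)` sees only that term of `r`: the others have another
    -- exponent over the same `d i`, or a shift-inequivalent `d i'`.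
    obtain ⟨N, φ, hφ, hφ', hother⟩ := (h.remainderFraction i j).exists_functional
    apply hφ'
    rw [← hφ r hsum, h.eq_sum, map_sum, Finset.sum_eq_single i _ (by simp), map_sum,
      Finset.sum_eq_single j _ (by simp)]
    · intro j' _ hj'
      refine hother (h.remainderFraction i j').pole (fun hj => absurd ?_ hj') _
        (h.remainderFraction i j').mem_part
      exact Fin.ext (Nat.succ_injective hj)
    · intro i' _ hi'
      rw [map_sum]
      exact Finset.sum_eq_zero fun j' _ => hother (h.remainderFraction i' j').pole
        (fun _ => h.not_shiftEquiv i' i hi') _ (h.remainderFraction i' j').mem_part
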